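/- Let $\mathcal H=L^2(\mathbb R^d;\mathbb C)$ with norm $\|\cdot\|$, and let $V:\mathbb R^d\to\mathbb R$ be a measurable potential with $\sup_x|V(x)|\le\nu$. Let $\psi:[0,T]\to\mathcal H$ be a differentiable solution (with $\psi(t)\in H^2(\mathbb R^d)$) of the Schrödinger equation $$ \mathrm i\,\dot\psi=-\Delta\psi+V\psi . $$ Let $\mathcal Q$ be a finite-dimensional complex inner product space with norm $\|\cdot\|_{\mathcal Q}$, let $U\subseteq\mathcal Q$ be open (for instance $U=\mathcal Q$), and let $\Phi:U\to\mathcal H$ be continuously differentiable with (real-linear) Fréchet derivative $\Phi'(q)$; if $\Phi$ is holomorphic, $\Phi'(q)$ is its complex derivative. Assume that the Laplacian maps parametrized functions into the tangent space: for every $q\in U$, $\Phi(q)\in H^2(\mathbb R^d)$ and there is $q^\Delta\in\mathcal Q$ (one such choice is fixed for every $q$) with $$ \Delta\Phi(q)=\Phi'(q)\,q^\Delta . $$ Let $\varepsilon(t)>0$ for $t\in[0,T]$. The modified regularized approximation is $u(t)=\Phi(q(t))$, where $q:[0,T]\to U$ is differentiable, $\Phi(q(0))=\psi(0)$, and for every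 $t\in[0,T]$ (argument $t$ omitted) $\dot u=\Phi'(q)\dot q$ and $$ \dot u-\mathrm i\Delta u=v,\qquad \dot q-\mathrm i q^\Delta=p,\qquad v=\Phi'(q)p, $$ with $p\in\mathcal Q$ such that $$ \|v+\mathrm iVu\|^2+\varepsilon^2\|p\|_{\mathcal Q}^2 \quad\text{is minimal.} $$ For $\rho>0$ define $\bar\delta_\rho(t)\ge 0$ by $$ \bar\delta_\rho(t)^2:=\sup_{q\in U:\ \|\Phi(q)-\psi(t)\|\le\rho}\ \min_{r\in\mathcal Q}\Bigl(\|\Phi'(q)r-(\dot\psi(t)-\mathrm i\Delta\psi(t))\|^2+\varepsilon(t)^2\|r\|_{\mathcal Q}^2\Bigr), $$ with $\sup\emptyset=0$. Then, for every $t\in[0,T]$, $$ \|u(t)-\psi(t)\|\le e^{\nu t}\int_0^t\bar\delta_\rho(s)\,ds \qquad\text{provided that}\qquad e^{\nu t}\int_0^t\bar\delta_\rho(s)\,ds\le\rho . $$ Here the integral is the Lebesgue integral of a nonnegative function (the lower Lebesgue integral, should $\varepsilon$, and hence $\bar\delta_\rho$, fail to be measurable). -/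

import Mathlib

open MeasureTheory Set Complex
open scoped ENNReal NNReal SchwartzMap Laplacian

noncomputable section

namespace SchrodingerParam

/-- The state space `ℋ = L²(ℝᵈ; ℂ)`. -/
abbrev L2 (d : ℕ) : Type :=
  Lp ℂ 2 (volume : Measure (EuclideanSpace ℝ (Fin d)))

/-- `g = Δ f` for `f, g ∈ L²(ℝᵈ)`: the distributional Laplacian of `f` is (represented by) `g`.
The `f` that admit such a `g` are exactly the elements of `H²(ℝᵈ)`, the domain of the
self-adjoint Laplacian. -/
def IsLaplacian {d : ℕ} (f g : L2 d) : Prop :=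
  Δ (Lp.toTemperedDistribution f) = Lp.toTemperedDistribution g

theorem memLp_potential_mul {d : ℕ} {V : EuclideanSpace ℝ (Fin d) → ℝ} {ν : ℝ}
    (hV : AEStronglyMeasurable V volume) (hν : ∀ x, |V x| ≤ ν) (f : L2 d) :
    MemLp (fun x => (V x : ℂ) * f x) 2 volume := by
  refine (Lp.memLp f).of_le_mul (c := ν) ?_ ?_
  · exact (Complex.continuous_ofReal.comp_aestronglyMeasurable hV).mul
      (Lp.aestronglyMeasurable f)
  · refine Filter.Eventually.of_forall fun x => ?_
    rw [norm_mul, Complex.norm_real, Real.norm_eq_abs]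
    exact mul_le_mul_of_nonneg_right (hν x) (norm_nonneg _)

/-- Multiplication `f ↦ V f` on `L²(ℝᵈ)` by a bounded real potential `V`. -/
def potentialMul {d : ℕ} {V : EuclideanSpace ℝ (Fin d) → ℝ} {ν : ℝ}
    (hV : AEStronglyMeasurable V volume) (hν : ∀ x, |V x| ≤ ν) (f : L2 d) : L2 d :=
  (memLp_potential_mul hV hν f).toLp (fun x => (V x : ℂ) * f x)

/-- `ψ` solves `i ψ' = -Δ ψ + V ψ` on `[0, T]` in `L²(ℝᵈ)`; `ψ' t` is the time derivative of `ψ`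
and `Lψ t` is the Laplacian of `ψ t`. -/
structure IsSchrodingerSolution {d : ℕ} {V : EuclideanSpace ℝ (Fin d) → ℝ} {ν : ℝ}
    (hV : AEStronglyMeasurable V volume) (hν : ∀ x, |V x| ≤ ν) (T : ℝ)
    (ψ ψ' Lψ : ℝ → L2 d) : Prop where
  hasDeriv : ∀ t ∈ Icc 0 T, HasDerivWithinAt ψ (ψ' t) (Icc 0 T) t
  laplacian : ∀ t ∈ Icc 0 T, IsLaplacian (ψ t) (Lψ t)
  equation : ∀ t ∈ Icc 0 T, I • ψ' t = -Lψ t + potentialMul hV hν (ψ t)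

/-- The modified regularized approximation on `[0, T]`. With `Φ' = fderiv ℝ Φ`, `u = Φ(q)` and
`Δ u = Φ'(q) q^Δ`, the curve `q` satisfies `u' - i Δ u = Φ'(q) p` and `q' - i q^Δ = p`, where `p`
minimizes `‖Φ'(q) p + i V u‖² + ε² ‖p‖²`. -/
structure IsModifiedApproximation {d : ℕ} {V : EuclideanSpace ℝ (Fin d) → ℝ} {ν : ℝ}
    (hV : AEStronglyMeasurable V volume) (hν : ∀ x, |V x| ≤ ν)
    {Q : Type*} [NormedAddCommGroup Q] [InnerProductSpace ℂ Q]
    (U : Set Q) (Φ : Q → L2 d) (qΔ : Q → Q) (ε : ℝ → ℝ) (T : ℝ)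
    (q q' p : ℝ → Q) : Prop where
  mem : ∀ t ∈ Icc 0 T, q t ∈ U
  hasDeriv : ∀ t ∈ Icc 0 T, HasDerivWithinAt q (q' t) (Icc 0 T) t
  state_eq : ∀ t ∈ Icc 0 T,
    fderiv ℝ Φ (q t) (q' t) - I • fderiv ℝ Φ (q t) (qΔ (q t)) = fderiv ℝ Φ (q t) (p t)
  param_eq : ∀ t ∈ Icc 0 T, q' t - I • qΔ (q t) = p t
  minimal : ∀ t ∈ Icc 0 T, IsMinOn
    (fun r : Q => ‖fderiv ℝ Φ (q t) r + I • potentialMul hV hν (Φ (q t))‖ ^ 2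
      + ε t ^ 2 * ‖r‖ ^ 2) univ (p t)

/-- The quantity `δ̄_ρ(t) ∈ [0, ∞]`, where
`δ̄_ρ(t)² = sup_{q ∈ U, ‖Φ(q) - ψ(t)‖ ≤ ρ} min_r (‖Φ'(q) r - g(t)‖² + ε(t)² ‖r‖²)`.
It is used with `g = ψ' - i Δ ψ`. -/
def deltaBar {d : ℕ} {Q : Type*} [NormedAddCommGroup Q] [InnerProductSpace ℂ Q]
    (U : Set Q) (Φ : Q → L2 d) (ε : ℝ → ℝ) (ψ g : ℝ → L2 d) (ρ t : ℝ) : ℝ≥0∞ :=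
  (⨆ q ∈ {q ∈ U | ‖Φ q - ψ t‖ ≤ ρ}, ⨅ r : Q,
    ENNReal.ofReal (‖fderiv ℝ Φ q r - g t‖ ^ 2 + ε t ^ 2 * ‖r‖ ^ 2)) ^ (1 / 2 : ℝ)

end SchrodingerParam

end

/-! Energy estimate for the error `e = u - ψ`. Subtracting the equations gives `e' = iΔe - iVe + (v
+ iVu)`. Since `Δ` and `V` are symmetric, the first two terms have no real inner product with `e`,
so `‖e‖' ≤ ‖v + iVu‖` (`re_inner_error_le`).

Since `iVu = -(ψ' - iΔψ) + iVe`, comparing the minimizer `p` with an arbitrary `r` gives `‖v + iVu‖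
≤ δ̄_ρ + ν‖e‖` as long as `‖e‖ ≤ ρ` (`norm_residual_sub_le_deltaBar`). Gronwall's inequality
(`gronwall_lintegral`) then yields the bound, and a continuation argument
(`norm_le_of_norm_deriv_le_of_norm_le`) shows that `‖e‖` cannot exceed `ρ` earlier. -/

namespace SchrodingerParam

/-! ### Symmetry of the Laplacian. -/

open FourierTransform in
theorem IsLaplacian.fourier_ae_eq {d : ℕ} {f g : L2 d} (h : IsLaplacian f g) :
    ∀ᵐ ξ : EuclideanSpace ℝ (Fin d),
      (𝓕 g : L2 d) ξ = ((-(2 * Real.pi) ^ 2 * ‖ξ‖ ^ 2 : ℝ) : ℂ) * (𝓕 f : L2 d) ξ := by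
  have hF : ∀ u : 𝓢(EuclideanSpace ℝ (Fin d), ℂ),
      ∫ x, u x • (𝓕 g : L2 d) x
        = ∫ x, u x • (((-(2 * Real.pi) ^ 2 * ‖x‖ ^ 2 : ℝ) : ℂ) * (𝓕 f : L2 d) x) := by
    intro u
    have hg : (fun x : EuclideanSpace ℝ (Fin d) => ((‖x‖ ^ 2 : ℝ) : ℂ)).HasTemperateGrowth := by
      fun_prop
    have h1 := congrArg (fun D => D (𝓕 u)) h
    simp only [TemperedDistribution.laplacian_eq_fourierMultiplierCLM, smul_apply,
      TemperedDistribution.fourierMultiplierCLM_apply, ← TemperedDistribution.fourier_apply,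
      Lp.fourier_toTemperedDistribution_eq, Lp.toTemperedDistribution_apply] at h1
    rw [FourierTransform.fourier_fourierInv_eq, TemperedDistribution.smulLeftCLM_apply_apply,
      Lp.toTemperedDistribution_apply] at h1
    rw [← h1, ← integral_smul]
    refine integral_congr_ae (Filter.Eventually.of_forall fun x => ?_)
    simp only [SchwartzMap.smulLeftCLM_apply_apply hg, smul_eq_mul, Complex.real_smul]
    push_cast
    ring
  refine ae_eq_of_integral_contDiff_smul_eq ?_ ?_ ?_
  · exact (Lp.memLp _).locallyIntegrable (by norm_num)
  · have hf := (Lp.memLp (𝓕 f : L2 d)).locallyIntegrable (by norm_num)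
    rw [← locallyIntegrableOn_univ] at hf ⊢
    exact hf.continuousOn_mul (by fun_prop) isOpen_univ.isLocallyClosed
  · intro φ hφ hc
    have hg₁ : HasCompactSupport (Complex.ofRealCLM ∘ φ) := hc.comp_left rfl
    have hg₂ : ContDiff ℝ (⊤ : ℕ∞) (Complex.ofRealCLM ∘ φ) := by fun_prop
    simpa using hF (hg₁.toSchwartzMap hg₂)

-- By Plancherel the inner product is the integral of the real function `-(2π‖ξ‖)²‖𝓕 f ξ‖²`.
open FourierTransform in
theorem IsLaplacian.im_inner_eq_zero {d : ℕ} {f g : L2 d} (h : IsLaplacian f g) :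
    (inner ℂ f g).im = 0 := by
  rw [← Lp.inner_fourier_eq, L2.inner_def]
  have h2 : ∀ᵐ ξ : EuclideanSpace ℝ (Fin d), inner ℂ ((𝓕 f : L2 d) ξ) ((𝓕 g : L2 d) ξ)
      = ((-(2 * Real.pi) ^ 2 * ‖ξ‖ ^ 2 * ‖(𝓕 f : L2 d) ξ‖ ^ 2 : ℝ) : ℂ) := by
    filter_upwards [h.fourier_ae_eq] with ξ hξ
    rw [hξ, ← smul_eq_mul, inner_smul_right, inner_self_eq_norm_sq_to_K]
    push_cast
    rfl
  rw [integral_congr_ae h2, integral_complex_ofReal, Complex.ofReal_im]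

theorem IsLaplacian.sub {d : ℕ} {f g f' g' : L2 d} (h : IsLaplacian f g) (h' : IsLaplacian f' g') :
    IsLaplacian (f - f') (g - g') := by
  have hs : ∀ a b : L2 d, Lp.toTemperedDistribution (a - b)
      = Lp.toTemperedDistribution a - Lp.toTemperedDistribution b := fun a b =>
    map_sub (Lp.toTemperedDistributionCLM ℂ (volume : Measure (EuclideanSpace ℝ (Fin d))) 2) a b
  unfold IsLaplacian at *
  rw [hs, hs, ← h, ← h']
  simp only [← TemperedDistribution.laplacianCLM_apply, map_sub]

/-! ### Multiplication by the bounded real potential. -/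

section Potential

variable {d : ℕ} {V : EuclideanSpace ℝ (Fin d) → ℝ} {ν : ℝ}
  (hV : AEStronglyMeasurable V volume) (hν : ∀ x, |V x| ≤ ν)

theorem potentialMul_coeFn (f : L2 d) :
    potentialMul hV hν f =ᵐ[volume] fun x => (V x : ℂ) * f x :=
  MemLp.coeFn_toLp _

theorem potentialMul_sub (f g : L2 d) :
    potentialMul hV hν (f - g) = potentialMul hV hν f - potentialMul hV hν g := by
  apply Lp.ext
  filter_upwards [potentialMul_coeFn hV hν (f - g), potentialMul_coeFn hV hν f,
    potentialMul_coeFn hV hν g, Lp.coeFn_sub f g,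
    Lp.coeFn_sub (potentialMul hV hν f) (potentialMul hV hν g)] with x h1 h2 h3 h4 h5
  rw [h1, h5, Pi.sub_apply, h2, h3, h4, Pi.sub_apply, mul_sub]

theorem norm_potentialMul_le (f : L2 d) : ‖potentialMul hV hν f‖ ≤ ν * ‖f‖ := by
  apply Lp.norm_le_mul_norm_of_ae_le_mul
  filter_upwards [potentialMul_coeFn hV hν f] with x h1
  rw [h1, norm_mul, Complex.norm_real, Real.norm_eq_abs]
  exact mul_le_mul_of_nonneg_right (hν x) (norm_nonneg _)

theorem im_inner_potentialMul_eq_zero (f : L2 d) : (inner ℂ f (potentialMul hV hν f)).im = 0 := by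
  rw [L2.inner_def]
  have h2 : ∀ᵐ x, inner ℂ (f x) (potentialMul hV hν f x) = ((V x * ‖f x‖ ^ 2 : ℝ) : ℂ) := by
    filter_upwards [potentialMul_coeFn hV hν f] with x hx
    rw [hx, ← smul_eq_mul, inner_smul_right, inner_self_eq_norm_sq_to_K]
    push_cast
    rfl
  rw [integral_congr_ae h2, integral_complex_ofReal, Complex.ofReal_im]

end Potential

/-- A differential inequality `w' ≤ δ` integrates to a bound by the lower Lebesgue integral of `δ`,
which need not be measurable. -/
theorem ofReal_sub_le_lintegral_of_hasDerivAt {w w' : ℝ → ℝ} {δ : ℝ → ℝ≥0∞} {a b : ℝ} (hab : a ≤ b)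
    (hc : ContinuousOn w (Icc a b)) (hd : ∀ s ∈ Ioo a b, HasDerivAt w (w' s) s)
    (hle : ∀ s ∈ Ioo a b, ENNReal.ofReal (w' s) ≤ δ s) :
    ENNReal.ofReal (w b - w a) ≤ ∫⁻ s in Icc a b, δ s := by
  -- A derivative is always measurable, so `φ` is a measurable minorant of the possibly
  -- nonmeasurable `δ` on the open interval.
  set φ : ℝ → ℝ := fun s => max (deriv w s) 0 with hφ
  have hφm : Measurable φ := (measurable_deriv w).max measurable_const
  have hφ0 : ∀ s, 0 ≤ φ s := fun s => le_max_right _ _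
  have h1 : ∫⁻ s in Icc a b, ENNReal.ofReal (φ s) ≤ ∫⁻ s in Icc a b, δ s := by
    rw [← setLIntegral_congr Ioo_ae_eq_Icc, ← setLIntegral_congr (f := δ) Ioo_ae_eq_Icc]
    refine setLIntegral_mono' measurableSet_Ioo fun s hs => ?_
    simp only [hφ, (hd s hs).deriv]
    rw [ENNReal.ofReal_max, ENNReal.ofReal_zero, max_eq_left zero_le]
    exact hle s hs
  by_cases htop : ∫⁻ s in Icc a b, δ s = ∞
  · rw [htop]; exact le_top
  have hint : IntegrableOn φ (Icc a b) := by
    refine ⟨hφm.aestronglyMeasurable, ?_⟩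
    rw [hasFiniteIntegral_iff_ofReal (Filter.Eventually.of_forall hφ0)]
    exact h1.trans_lt (lt_top_iff_ne_top.2 htop)
  have h2 := intervalIntegral.sub_le_integral_of_hasDeriv_right_of_le hab hc
    (fun s hs => (hd s hs).hasDerivWithinAt) hint
    (fun s hs => by simp only [hφ, (hd s hs).deriv]; exact le_max_left _ _)
  refine (ENNReal.ofReal_le_ofReal h2).trans (le_trans (le_of_eq ?_) h1)
  rw [intervalIntegral.integral_of_le hab, ← integral_Icc_eq_integral_Ioc,
    ofReal_integral_eq_lintegral_ofReal hint (Filter.Eventually.of_forall hφ0)]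

/-- The integrating factor `exp (-νs)` is at most `1` because `ν, s ≥ 0`, so it can be dropped in
front of `δ`. -/
theorem gronwall_lintegral {f f' : ℝ → ℝ} {δ : ℝ → ℝ≥0∞} {a b ν : ℝ} (ha : 0 ≤ a) (hab : a ≤ b)
    (hν : 0 ≤ ν) (hc : ContinuousOn f (Icc a b)) (hd : ∀ s ∈ Ioo a b, HasDerivAt f (f' s) s)
    (hfa : f a = 0) (hle : ∀ s ∈ Ioo a b, ENNReal.ofReal (f' s - ν * f s) ≤ δ s) :
    ENNReal.ofReal (f b) ≤ ENNReal.ofReal (Real.exp (ν * b)) * ∫⁻ s in Icc a b, δ s := by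
  have hw := ofReal_sub_le_lintegral_of_hasDerivAt
    (w := fun s => Real.exp (-(ν * s)) * f s)
    (w' := fun s => Real.exp (-(ν * s)) * (f' s - ν * f s)) (δ := δ) hab
    (ContinuousOn.mul (by fun_prop) hc) ?_ ?_
  · simp only [hfa, mul_zero, sub_zero] at hw
    refine le_trans (le_of_eq ?_) (mul_le_mul_right hw _)
    rw [← ENNReal.ofReal_mul (Real.exp_pos _).le, ← mul_assoc, ← Real.exp_add, add_neg_cancel,
      Real.exp_zero, one_mul]
  · intro s hs
    have h1 : HasDerivAt (fun s : ℝ => Real.exp (-(ν * s))) (Real.exp (-(ν * s)) * -(ν * 1)) s :=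
      ((hasDerivAt_id s).const_mul ν).neg.exp
    convert! h1.mul (hd s hs) using 1
    ring
  · intro s hs
    refine le_trans ?_ (hle s hs)
    rcases le_total (f' s - ν * f s) 0 with h | h
    · rw [ENNReal.ofReal_of_nonpos (mul_nonpos_of_nonneg_of_nonpos (Real.exp_pos _).le h)]
      exact zero_le
    · refine ENNReal.ofReal_le_ofReal (mul_le_of_le_one_left h (Real.exp_le_one_iff.2 ?_))
      have := mul_nonneg hν (ha.trans hs.1.le)
      linarith

/-! ### Growth of the norm of a curve, and continuation. -/

section Norm

variable {H : Type*} [NormedAddCommGroup H] [InnerProductSpace ℂ H] [NormedSpace ℝ H]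

theorem hasDerivAt_norm_of_ne_zero {e : ℝ → H} {e' : H} {s : ℝ} (he : HasDerivAt e e' s)
    (h0 : e s ≠ 0) : HasDerivAt (fun x => ‖e x‖) ((inner ℂ (e s) e').re / ‖e s‖) s := by
  have h1 := Complex.reCLM.hasFDerivAt.comp_hasDerivAt s (he.inner ℂ he)
  have hpos : 0 < ‖e s‖ := norm_pos_iff.2 h0
  have hfun : (⇑Complex.reCLM ∘ fun x => inner ℂ (e x) (e x)) = fun x => ‖e x‖ ^ 2 := by
    ext x
    exact (inner_self_eq_norm_sq (𝕜 := ℂ) (e x))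
  rw [hfun] at h1
  have h2 := h1.sqrt (by positivity)
  simp only [Real.sqrt_sq (norm_nonneg _)] at h2
  convert! h2 using 1
  have h3 : (inner ℂ e' (e s)).re = (inner ℂ (e s) e').re := inner_re_symm (𝕜 := ℂ) e' (e s)
  simp only [Complex.reCLM_apply, Complex.add_re, h3]
  field_simp
  ring

theorem norm_le_of_norm_deriv_le {e e' : ℝ → H} {k : ℝ → ℝ} {δ : ℝ → ℝ≥0∞} {ν b : ℝ} (hν : 0 ≤ ν)
    (hb : 0 ≤ b) (hd : ∀ s ∈ Icc 0 b, HasDerivWithinAt e (e' s) (Icc 0 b) s) (h0 : e 0 = 0)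
    (hk : ∀ s ∈ Ioo 0 b, (inner ℂ (e s) (e' s)).re ≤ ‖e s‖ * k s)
    (hle : ∀ s ∈ Ioo 0 b, ENNReal.ofReal (k s - ν * ‖e s‖) ≤ δ s) :
    ENNReal.ofReal ‖e b‖ ≤ ENNReal.ofReal (Real.exp (ν * b)) * ∫⁻ s in Icc 0 b, δ s := by
  have hc : ContinuousOn e (Icc 0 b) := fun s hs => (hd s hs).continuousWithinAt
  have hK : IsCompact (Icc 0 b ∩ e ⁻¹' {0}) :=
    isCompact_Icc.of_isClosed_subset (hc.preimage_isClosed_of_isClosed isClosed_Icc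
      isClosed_singleton) inter_subset_left
  -- Restarting at the last zero of `e` avoids the points where the norm is not differentiable.
  obtain ⟨a, ⟨ha, hea⟩, hamax⟩ := hK.exists_isGreatest ⟨0, left_mem_Icc.2 hb, h0⟩
  have hea : e a = 0 := hea
  have hne : ∀ s ∈ Ioo a b, e s ≠ 0 := fun s hs h =>
    absurd (hamax ⟨⟨ha.1.trans hs.1.le, hs.2.le⟩, h⟩) (not_le.2 hs.1)
  have hsub : ∀ s ∈ Ioo a b, s ∈ Ioo 0 b := fun s hs => ⟨ha.1.trans_lt hs.1, hs.2⟩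
  refine (gronwall_lintegral (f := fun s => ‖e s‖) (δ := δ) ha.1 ha.2 hν
    (hc.mono (Icc_subset_Icc_left ha.1)).norm (fun s hs => hasDerivAt_norm_of_ne_zero
      ((hd s (Ioo_subset_Icc_self (hsub s hs))).hasDerivAt
        (Icc_mem_nhds (hsub s hs).1 (hsub s hs).2)) (hne s hs)) (by simp [hea]) ?_).trans ?_
  · intro s hs
    refine (ENNReal.ofReal_le_ofReal (sub_le_sub_right ?_ _)).trans (hle s (hsub s hs))
    rw [div_le_iff₀ (norm_pos_iff.2 (hne s hs)), mul_comm]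
    exact hk s (hsub s hs)
  · gcongr
    exact ha.1

/-- Continuation argument: the differential inequality is only needed while `‖e‖ ≤ ρ`. -/
theorem norm_le_of_norm_deriv_le_of_norm_le {e e' : ℝ → H} {k : ℝ → ℝ} {δ : ℝ → ℝ≥0∞}
    {ν ρ t : ℝ} (hν : 0 ≤ ν) (hρ : 0 < ρ)
    (ht : 0 ≤ t) (hd : ∀ s ∈ Icc 0 t, HasDerivWithinAt e (e' s) (Icc 0 t) s) (h0 : e 0 = 0)
    (hk : ∀ s ∈ Icc 0 t, (inner ℂ (e s) (e' s)).re ≤ ‖e s‖ * k s)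
    (hle : ∀ s ∈ Icc 0 t, ‖e s‖ ≤ ρ → ENNReal.ofReal (k s - ν * ‖e s‖) ≤ δ s)
    (hδ : ν = 0 → ∀ s ∈ Icc 0 t, δ s = 0)
    (hbound : ENNReal.ofReal (Real.exp (ν * t)) * ∫⁻ s in Icc 0 t, δ s ≤ ENNReal.ofReal ρ) :
    ENNReal.ofReal ‖e t‖ ≤ ENNReal.ofReal (Real.exp (ν * t)) * ∫⁻ s in Icc 0 t, δ s := by
  have key : ∀ b ∈ Icc 0 t, (∀ s ∈ Ioo 0 b, ‖e s‖ ≤ ρ) →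
      ENNReal.ofReal ‖e b‖ ≤ ENNReal.ofReal (Real.exp (ν * b)) * ∫⁻ s in Icc 0 b, δ s := by
    intro b hb hs
    have hsub : ∀ s ∈ Ioo 0 b, s ∈ Icc 0 t := fun s hs => ⟨hs.1.le, hs.2.le.trans hb.2⟩
    exact norm_le_of_norm_deriv_le hν hb.1
      (fun s hs => (hd s ⟨hs.1, hs.2.trans hb.2⟩).mono (Icc_subset_Icc_right hb.2)) h0
      (fun s hs => hk s (hsub s hs)) fun s h => hle s (hsub s h) (hs s h)
  refine key t (right_mem_Icc.2 ht) ?_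
  by_contra! hcon
  obtain ⟨s₀, hs₀, hlt⟩ := hcon
  have hc : ContinuousOn (fun s => ‖e s‖) (Icc 0 s₀) := fun s hs =>
    ((hd s ⟨hs.1, hs.2.trans hs₀.2.le⟩).continuousWithinAt.mono
      (Icc_subset_Icc_right hs₀.2.le)).norm
  have hK : IsCompact (Icc 0 s₀ ∩ (fun s => ‖e s‖) ⁻¹' Ici ρ) :=
    isCompact_Icc.of_isClosed_subset (hc.preimage_isClosed_of_isClosed isClosed_Icc
      isClosed_Ici) inter_subset_left
  -- At the first time `b < t` with `‖e b‖ ≥ ρ` the estimate already applies.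
  obtain ⟨b, ⟨hb, hρb⟩, hbmin⟩ := hK.exists_isLeast ⟨s₀, right_mem_Icc.2 hs₀.1.le, hlt.le⟩
  have hρb : ρ ≤ ‖e b‖ := hρb
  have hbt : b < t := hb.2.trans_lt hs₀.2
  have hEb := key b ⟨hb.1, hbt.le⟩ fun s hs => by
    by_contra! h
    exact absurd (hbmin ⟨⟨hs.1.le, hs.2.le.trans hb.2⟩, h.le⟩) (not_le.2 hs.2)
  set J := ∫⁻ s in Icc 0 t, δ s with hJ
  have hJb : ENNReal.ofReal ρ ≤ ENNReal.ofReal (Real.exp (ν * b)) * J := by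
    refine (ENNReal.ofReal_le_ofReal hρb).trans (hEb.trans ?_)
    rw [hJ]
    gcongr
  -- For `ν > 0` the contradiction is `exp (νb) < exp (νt)`; for `ν = 0` this strictness is lost,
  -- and `hδ` replaces it.
  rcases hν.eq_or_lt with h | h
  · have hJ0 : J = 0 := by
      rw [hJ, setLIntegral_congr_fun measurableSet_Icc (hδ h.symm), lintegral_zero]
    rw [hJ0, mul_zero, nonpos_iff_eq_zero, ENNReal.ofReal_eq_zero] at hJb
    exact absurd hJb (not_le.2 hρ)
  · have hJtop : J ≠ ∞ := by
      intro hJt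
      rw [hJt, ENNReal.mul_top (by simp [Real.exp_pos])] at hbound
      exact ENNReal.ofReal_ne_top (top_le_iff.1 hbound)
    obtain ⟨j, hj⟩ : ∃ j, J.toReal = j := ⟨_, rfl⟩
    have hJeq : J = ENNReal.ofReal j := by rw [← hj, ENNReal.ofReal_toReal hJtop]
    have hj0 : 0 ≤ j := hj ▸ ENNReal.toReal_nonneg
    rw [hJeq, ← ENNReal.ofReal_mul (Real.exp_pos _).le] at hJb hbound
    rw [ENNReal.ofReal_le_ofReal_iff hρ.le] at hbound
    rw [ENNReal.ofReal_le_ofReal_iff (by positivity)] at hJb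
    have hjpos : 0 < j := by
      rcases hj0.eq_or_lt with h | h
      · rw [← h, mul_zero] at hJb
        exact absurd hJb (not_le.2 hρ)
      · exact h
    have := mul_lt_mul_of_pos_right (Real.exp_lt_exp.2 (mul_lt_mul_of_pos_left hbt h)) hjpos
    linarith

end Norm

/-! ### Residual and error equation. -/

/-- Triangle inequality for the pairs `(x, √c)` and `(y, 0)` in the Euclidean product norm. -/
theorem sub_le_sqrt_of_norm_add_sq_le {E : Type*} [SeminormedAddCommGroup E] {x y : E}
    {k c m A : ℝ} (hk : k ^ 2 ≤ ‖x + y‖ ^ 2 + c) (hc : 0 ≤ c) (hA : ‖x‖ ^ 2 + c = A)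
    (hy : ‖y‖ ≤ m) : k - m ≤ √A := by
  have hx : ‖x‖ ≤ √A := Real.le_sqrt_of_sq_le (by linarith)
  have hm : 0 ≤ m := (norm_nonneg y).trans hy
  have hA0 : 0 ≤ A := by rw [← hA]; positivity
  have h1 : ‖x + y‖ ^ 2 ≤ (‖x‖ + m) ^ 2 :=
    pow_le_pow_left₀ (norm_nonneg _) ((norm_add_le x y).trans (by gcongr)) 2
  have h2 : k ^ 2 ≤ (√A + m) ^ 2 := by
    have := Real.sq_sqrt hA0
    have := mul_le_mul_of_nonneg_right hx hm
    nlinarith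
  have := abs_le_of_sq_le_sq' h2 (by positivity)
  linarith [this.2]

theorem le_deltaBar {d : ℕ} {Q : Type*} [NormedAddCommGroup Q] [InnerProductSpace ℂ Q]
    {U : Set Q} {Φ : Q → L2 d} {ε : ℝ → ℝ} {ψ g : ℝ → L2 d} {ρ t a : ℝ} {q : Q} (hq : q ∈ U)
    (hρ : ‖Φ q - ψ t‖ ≤ ρ)
    (h : ∀ r : Q, a ≤ √(‖fderiv ℝ Φ q r - g t‖ ^ 2 + ε t ^ 2 * ‖r‖ ^ 2)) :
    ENNReal.ofReal a ≤ deltaBar U Φ ε ψ g ρ t := by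
  unfold deltaBar
  rw [one_div, ENNReal.le_rpow_inv_iff (by norm_num)]
  refine le_trans ?_ (le_iSup₂ (f := fun q (_ : q ∈ {q ∈ U | ‖Φ q - ψ t‖ ≤ ρ}) => ⨅ r : Q,
    ENNReal.ofReal (‖fderiv ℝ Φ q r - g t‖ ^ 2 + ε t ^ 2 * ‖r‖ ^ 2)) q ⟨hq, hρ⟩)
  refine le_iInf fun r => ?_
  refine (ENNReal.rpow_le_rpow (ENNReal.ofReal_le_ofReal (h r)) (by norm_num)).trans ?_
  rw [ENNReal.rpow_ofNat, ← ENNReal.ofReal_pow (Real.sqrt_nonneg _),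
    Real.sq_sqrt (by positivity)]

theorem deltaBar_eq_zero {d : ℕ} {Q : Type*} [NormedAddCommGroup Q] [InnerProductSpace ℂ Q]
    {U : Set Q} {Φ : Q → L2 d} {ε : ℝ → ℝ} {ψ g : ℝ → L2 d} {ρ t : ℝ} (hg : g t = 0) :
    deltaBar U Φ ε ψ g ρ t = 0 := by
  unfold deltaBar
  rw [ENNReal.rpow_eq_zero_iff_of_pos (by norm_num)]
  simp only [ENNReal.iSup_eq_zero]
  intro q _
  refine le_antisymm ((iInf_le _ 0).trans (by simp [hg])) zero_le

theorem re_inner_I_smul {H : Type*} [NormedAddCommGroup H] [InnerProductSpace ℂ H] {x y : H}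
    (h : (inner ℂ x y).im = 0) : (inner ℂ x (I • y)).re = 0 := by
  rw [inner_smul_right]
  simp [h]

variable {d : ℕ} {V : EuclideanSpace ℝ (Fin d) → ℝ} {ν : ℝ}
  {hV : AEStronglyMeasurable V volume} {hν : ∀ x, |V x| ≤ ν} {T : ℝ} {ψ ψ' Lψ : ℝ → L2 d}

theorem IsSchrodingerSolution.deriv_eq (hψ : IsSchrodingerSolution hV hν T ψ ψ' Lψ) {s : ℝ}
    (hs : s ∈ Icc 0 T) : ψ' s = I • Lψ s - I • potentialMul hV hν (ψ s) := by
  have h := congrArg (fun x => -(I • x)) (hψ.equation s hs)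
  simp only [smul_smul, I_mul_I, smul_add, smul_neg, neg_smul, one_smul, neg_neg] at h
  rw [h]
  abel

variable {Q : Type*} [NormedAddCommGroup Q] [InnerProductSpace ℂ Q]
  {U : Set Q} {Φ : Q → L2 d} {qΔ : Q → Q} {ε : ℝ → ℝ} {q q' p : ℝ → Q}

theorem re_inner_error_le
    (hψ : IsSchrodingerSolution hV hν T ψ ψ' Lψ)
    (hLap : ∀ q ∈ U, IsLaplacian (Φ q) (fderiv ℝ Φ q (qΔ q)))
    (hq : IsModifiedApproximation hV hν U Φ qΔ ε T q q' p) {s : ℝ} (hs : s ∈ Icc 0 T) :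
    (inner ℂ (Φ (q s) - ψ s) (fderiv ℝ Φ (q s) (q' s) - ψ' s)).re
      ≤ ‖Φ (q s) - ψ s‖ *
        ‖fderiv ℝ Φ (q s) (p s) + I • potentialMul hV hν (Φ (q s))‖ := by
  -- The error equation: a skew part acting on the error, plus the residual.
  have he : fderiv ℝ Φ (q s) (q' s) - ψ' s
      = I • (fderiv ℝ Φ (q s) (qΔ (q s)) - Lψ s)
        - I • potentialMul hV hν (Φ (q s) - ψ s)
        + (fderiv ℝ Φ (q s) (p s) + I • potentialMul hV hν (Φ (q s))) := by
    rw [← hq.state_eq s hs, hψ.deriv_eq hs, potentialMul_sub, smul_sub, smul_sub]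
    abel
  rw [he, inner_add_right, inner_sub_right, Complex.add_re, Complex.sub_re,
    re_inner_I_smul ((hLap _ (hq.mem s hs)).sub (hψ.laplacian s hs)).im_inner_eq_zero,
    re_inner_I_smul (im_inner_potentialMul_eq_zero hV hν _), sub_zero, zero_add]
  exact re_inner_le_norm (𝕜 := ℂ) _ _

theorem norm_residual_sub_le_deltaBar
    (hψ : IsSchrodingerSolution hV hν T ψ ψ' Lψ)
    (hq : IsModifiedApproximation hV hν U Φ qΔ ε T q q' p) {s ρ : ℝ} (hs : s ∈ Icc 0 T)
    (hρ : ‖Φ (q s) - ψ s‖ ≤ ρ) :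
    ENNReal.ofReal (‖fderiv ℝ Φ (q s) (p s) + I • potentialMul hV hν (Φ (q s))‖
        - ν * ‖Φ (q s) - ψ s‖)
      ≤ deltaBar U Φ ε ψ (fun s => ψ' s - I • Lψ s) ρ s := by
  refine le_deltaBar (hq.mem s hs) hρ fun r => ?_
  refine sub_le_sqrt_of_norm_add_sq_le (c := ε s ^ 2 * ‖r‖ ^ 2)
    (y := I • potentialMul hV hν (Φ (q s) - ψ s)) ?_ (by positivity) rfl ?_
  · have hmin := isMinOn_iff.1 (hq.minimal s hs) r (mem_univ r)
    have hr : fderiv ℝ Φ (q s) r - (ψ' s - I • Lψ s) + I • potentialMul hV hν (Φ (q s) - ψ s)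
        = fderiv ℝ Φ (q s) r + I • potentialMul hV hν (Φ (q s)) := by
      rw [hψ.deriv_eq hs, potentialMul_sub, smul_sub]
      abel
    rw [hr]
    refine le_trans ?_ hmin
    exact le_add_of_nonneg_right (by positivity)
  · rw [norm_smul, norm_I, one_mul]
    exact norm_potentialMul_le hV hν _

end SchrodingerParam

theorem mainTheorem7 {d : ℕ}
    {Q : Type*} [NormedAddCommGroup Q] [InnerProductSpace ℂ Q] [FiniteDimensional ℂ Q]
    (V : EuclideanSpace ℝ (Fin d) → ℝ) (ν : ℝ)
    (hV : AEStronglyMeasurable V volume) (hν : ∀ x, |V x| ≤ ν)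
    (U : Set Q) (hU : IsOpen U)
    (Φ : Q → SchrodingerParam.L2 d) (hΦ : ContDiffOn ℝ 1 Φ U)
    (qΔ : Q → Q)
    (hLap : ∀ q ∈ U, SchrodingerParam.IsLaplacian (Φ q) (fderiv ℝ Φ q (qΔ q)))
    (T : ℝ) (ε : ℝ → ℝ) (hε : ∀ t ∈ Icc 0 T, 0 < ε t)
    (ψ ψ' Lψ : ℝ → SchrodingerParam.L2 d)
    (hψ : SchrodingerParam.IsSchrodingerSolution hV hν T ψ ψ' Lψ)
    (q q' p : ℝ → Q)
    (hq : SchrodingerParam.IsModifiedApproximation hV hν U Φ qΔ ε T q q' p)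
    (hinit : Φ (q 0) = ψ 0)
    (ρ : ℝ) (hρ : 0 < ρ)
    (t : ℝ) (ht : t ∈ Icc 0 T)
    (hbound : ENNReal.ofReal (Real.exp (ν * t)) *
        ∫⁻ s in Icc 0 t,
          SchrodingerParam.deltaBar U Φ ε ψ (fun s => ψ' s - Complex.I • Lψ s) ρ s
      ≤ ENNReal.ofReal ρ) :
    ENNReal.ofReal ‖Φ (q t) - ψ t‖ ≤
      ENNReal.ofReal (Real.exp (ν * t)) *
        ∫⁻ s in Icc 0 t,
          SchrodingerParam.deltaBar U Φ ε ψ (fun s => ψ' s - Complex.I • Lψ s) ρ s := by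
  have hν0 : 0 ≤ ν := (abs_nonneg _).trans (hν 0)
  have hsub : ∀ s ∈ Icc 0 t, s ∈ Icc 0 T := fun s hs => ⟨hs.1, hs.2.trans ht.2⟩
  refine SchrodingerParam.norm_le_of_norm_deriv_le_of_norm_le (e := fun s => Φ (q s) - ψ s)
    (e' := fun s => fderiv ℝ Φ (q s) (q' s) - ψ' s)
    (k := fun s => ‖fderiv ℝ Φ (q s) (p s)
      + Complex.I • SchrodingerParam.potentialMul hV hν (Φ (q s))‖)
    hν0 hρ ht.1 ?_ (sub_eq_zero.2 hinit)
    (fun s hs => SchrodingerParam.re_inner_error_le hψ hLap hq (hsub s hs))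
    (fun s hs hle => SchrodingerParam.norm_residual_sub_le_deltaBar hψ hq (hsub s hs) hle)
    ?_ hbound
  · intro s hs
    have hs' := hsub s hs
    have hdΦ : HasFDerivAt Φ (fderiv ℝ Φ (q s)) (q s) :=
      ((hΦ.differentiableOn one_ne_zero).differentiableAt
        (hU.mem_nhds (hq.mem s hs'))).hasFDerivAt
    exact ((hdΦ.comp_hasDerivWithinAt s (hq.hasDeriv s hs')).sub (hψ.hasDeriv s hs')).mono
      (Icc_subset_Icc_right ht.2)
  -- If `ν = 0` then `Vψ = 0`, so `ψ' - iΔψ = 0` and `r = 0` makes every minimum in `deltaBar`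
  -- vanish.
  · intro h0 s hs
    apply SchrodingerParam.deltaBar_eq_zero
    have hz : SchrodingerParam.potentialMul hV hν (ψ s) = 0 := by
      rw [← norm_le_zero_iff]
      simpa [h0] using SchrodingerParam.norm_potentialMul_le hV hν (ψ s)
    rw [hψ.deriv_eq (hsub s hs), hz, smul_zero, sub_zero, sub_self]
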